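/- Let $p$ be a prime and let $k$ be a perfect field of characteristic $p$. Let $S/R$ be a finite extension of complete discrete valuation rings, where $R$ is a $k$-algebra whose residue field is perfect (for instance, residue field $k$). Write $\mathrm{QF}(\cdot)$ for the fraction field and $v_R, v_S$ for the normalized discrete valuations (with value group $\mathbb{Z}$) of $\mathrm{QF}(R)$, $\mathrm{QF}(S)$. Assume that $\mathrm{QF}(S)/\mathrm{QF}(R)$ is Galois, with Galois group $G$, and for $i \ge -1$ let $$G_i=\{\sigma\in G : v_S(\sigma x-x)\ge i+1 \text{ for all } x\in S\}$$ be the ramification groups (lower numbering). Assume that $G=G_1$. Let $L$ be the subfield of $\mathrm{QF}(S)$ generated over $\mathrm{QF}(R)$ by all $\alpha\in \mathrm{QF}(S)$ such that $\alpha^p-\alpha\in \mathrm{QF}(R)$ and $v_R(\alpha^p-\alpha)=-1$. Then $$G_2=\mathrm{Gal}(\mathrm{QF}(S)/L).$$ -/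

import Mathlib

open scoped WithZero

/-- The normalized valuation of a discrete valuation ring `R` on its fraction field `K`, written
multiplicatively: the value `exp (-n)` corresponds to `v_R = n`, and `0` to `v_R = ∞`. -/
noncomputable def dvrValuation (R K : Type*) [CommRing R] [IsDomain R]
    [IsDiscreteValuationRing R] [Field K] [Algebra R K] [IsFractionRing R K] :
    Valuation K ℤᵐ⁰ :=
  (IsDiscreteValuationRing.maximalIdeal R).valuation K

/-- If `S` is integral over `R` and integrally closed in its fraction field `E`, then every
automorphism of `E` over `K = Frac R` maps `S` to `S`. -/
theorem exists_algebraMap_eq_galois (R S K E : Type*) [CommRing R]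
    [CommRing S] [IsDomain S] [IsDiscreteValuationRing S] [Algebra R S] [Algebra.IsIntegral R S]
    [Field K] [Algebra R K] [Field E] [Algebra S E] [IsFractionRing S E] [Algebra K E]
    [Algebra R E] [IsScalarTower R S E] [IsScalarTower R K E] (σ : Gal(E/K)) (x : S) :
    ∃ y : S, algebraMap S E y = σ (algebraMap S E x) := by
  have h1 : IsIntegral R (algebraMap S E x) := (Algebra.IsIntegral.isIntegral (R := R) x).algebraMap
  have h2 : IsIntegral R (σ (algebraMap S E x)) := h1.map (σ.toAlgHom.restrictScalars R)
  exact IsIntegrallyClosed.isIntegral_iff.mp (h2.tower_top (A := S))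

/-- The `i`-th ramification group `{σ ∈ G | v_S (σ x - x) ≥ i + 1 for all x ∈ S}` (lower
numbering) of the Galois group `G = Gal(E/K)`, where `E = Frac S` and `K = Frac R`. -/
noncomputable def ramificationGroup (R S K E : Type*) [CommRing R]
    [CommRing S] [IsDomain S] [IsDiscreteValuationRing S] [Algebra R S] [Algebra.IsIntegral R S]
    [Field K] [Algebra R K] [Field E] [Algebra S E] [IsFractionRing S E] [Algebra K E]
    [Algebra R E] [IsScalarTower R S E] [IsScalarTower R K E] (i : ℤ) : Subgroup Gal(E/K) where
  carrier := {σ | ∀ x : S,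
    dvrValuation S E (σ (algebraMap S E x) - algebraMap S E x) ≤ WithZero.exp (-(i + 1))}
  one_mem' := fun x => by simp
  mul_mem' := by
    intro σ τ hσ hτ x
    obtain ⟨y, hy⟩ := exists_algebraMap_eq_galois R S K E τ x
    have h : (σ * τ) (algebraMap S E x) - algebraMap S E x =
        (σ (algebraMap S E y) - algebraMap S E y) +
          (τ (algebraMap S E x) - algebraMap S E x) := by
      rw [AlgEquiv.mul_apply, hy]; ring
    rw [h]
    exact (dvrValuation S E).map_add_le (hσ y) (hτ x)
  inv_mem' := by
    intro σ hσ x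
    obtain ⟨y, hy⟩ := exists_algebraMap_eq_galois R S K E σ⁻¹ x
    have hx : σ (algebraMap S E y) = algebraMap S E x := by
      rw [hy, ← AlgEquiv.mul_apply, mul_inv_cancel, AlgEquiv.one_apply]
    have h := hσ y
    rw [hx, hy, Valuation.map_sub_swap] at h
    exact h

/-- The subfield of `E` generated over `K = Frac R` by all `α ∈ E` such that `α ^ p - α` lies in
`K` and `v_R (α ^ p - α) = -1`. -/
noncomputable def conductorOneSubfield (R K E : Type*) [CommRing R] [IsDomain R]
    [IsDiscreteValuationRing R] [Field K] [Algebra R K] [IsFractionRing R K] [Field E]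
    [Algebra K E] (p : ℕ) : IntermediateField K E :=
  IntermediateField.adjoin K
    {α : E | ∃ β : K, algebraMap K E β = α ^ p - α ∧ dvrValuation R K β = WithZero.exp 1}

/-!
As `G = G₁` acts trivially on the residue field of `S`, and the residue field of `R` is perfect, the
residue extension is trivial (`residueField_algebraMap_surjective`). Hence `S = R[π]` for every
uniformizer `π` of `S` (`adjoin_irreducible_eq_top`), the ramification index is `[E : K]`
(`dvrValuation_algebraMap_eq_pow`), and `σ ∈ G₂` holds if and only if `v_S (σ π - π) ≥ 3`.

Let `α ^ p - α = β ∈ K` with `v_R β = -m`, where `p ∤ m`, and let `H` be the subgroup fixing `α`; it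
has `[E : K] / p` elements, so `v_S α = -m |H|`. Suppose that `σ` moves `α`. The two inequalities
behind the formula for the ramification groups of a quotient of `G` bound the value of
`∏ (π - σ h π)`, the product being over `h ∈ H`, from above and from below:

* If `y ∈ S` is fixed by `H`, this product divides `y - σ y` (`prod_sub_smul_dvd_sub`). For `m = 1`
  and `y = α⁻¹` the value of `y - σ y` is `2 |H|`. All factors of the product have value at least
  `2`, and the one with `h = 1` has value at least `3` if `σ ∈ G₂`, which is absurd. So `G₂` fixes
  `α` (`apply_eq_of_mem_pow_three`).
* Conversely, the product lies in every ideal that contains all `σ z - z` with `z ∈ S` fixed by `H`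
  (`prod_sub_smul_mem`), and these `σ z - z` have value at least `(m + 1) |H|`
  (`valuation_sub_le_of_mem_adjoin_artinSchreier`). If every automorphism that moves `α` shifts `π`
  by an element of value exactly `2`, then `m ≤ 1` follows (`le_one_of_artinSchreier`).

The second point gives `Gal(E/L) ⊆ G₂`. The residue class of `(σ π - π) / π ^ 2` is additive in `σ`
and detects `G₂` (`exists_residue_character`). If `σ ∉ G₂`, composing it with an `𝔽_p`-linear form
yields a character `χ` of `G` with values in `𝔽_p` and `χ σ ≠ 0`. By additive Hilbert 90 it comes
from some `α` with `τ α = α + χ τ` and `α ^ p - α ∈ K` (`exists_artinSchreier_generator`). Changing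
`α` by an element of `K` makes `α ^ p - α` integral or of pole order `m` prime to `p`
(`exists_sub_artinSchreier_reduced`). The integral case contradicts `G = G₁`, and in the other case
`m = 1`, so that `α ∈ L`, while `σ α ≠ α`.
-/

/-! ### Products over cosets of a group of automorphisms -/

/-- Writing `y = g(x)`, the elements `s i • x` are distinct roots of the polynomial `g - z`, whose
value at `x` is `y - z`. -/
theorem prod_sub_smul_dvd_sub {R S G ι : Type*} [CommRing R] [CommRing S] [IsDomain S]
    [Algebra R S] [Group G] [MulSemiringAction G S] [SMulCommClass G R S] {x y z : S}
    (hy : y ∈ Algebra.adjoin R {x}) (T : Finset ι) (s : ι → G)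
    (hinj : Set.InjOn (fun i => s i • x) T) (hT : ∀ i ∈ T, s i • y = z) :
    ∏ i ∈ T, (x - s i • x) ∣ y - z := by
  classical
  obtain ⟨g, rfl⟩ := Algebra.adjoin_singleton_eq_range_aeval R x ▸ hy
  simp only [AlgHom.toRingHom_eq_coe, RingHom.coe_coe] at hT ⊢
  set P : Polynomial S := g.map (algebraMap R S) - Polynomial.C z with hP
  have hPeval (a : S) : P.eval a = Polynomial.aeval a g - z := by simp [hP, Polynomial.aeval_def]
  have hroot (i) (hi : i ∈ T) : P.eval (s i • x) = 0 := by
    rw [hPeval, ← hT i hi, sub_eq_zero]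
    exact Polynomial.aeval_algHom_apply (MulSemiringAction.toAlgHom R S (s i)) x g
  have hdvd : ∏ i ∈ T, (Polynomial.X - Polynomial.C (s i • x)) ∣ P := by
    by_cases hP0 : P = 0
    · simp [hP0]
    have hle : T.val.map (fun i => s i • x) ≤ P.roots := by
      refine (Multiset.le_iff_subset (Finset.nodup_map_iff_injOn.mpr hinj)).mpr fun a ha => ?_
      obtain ⟨i, hi, rfl⟩ := Multiset.mem_map.mp ha
      exact (Polynomial.mem_roots hP0).mpr (hroot i hi)
    simpa [Multiset.map_map] using! (Multiset.prod_X_sub_C_dvd_iff_le_roots hP0 _).mpr hle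
  have := Polynomial.eval_dvd (x := x) hdvd
  simpa [Polynomial.eval_prod, hPeval] using this

/-- The polynomial `f` with roots `h • x`, `h ∈ H`, has coefficients fixed by `H`, so those of `σ •
f - f` lie in `I`; the product is the value of `σ • f - f` at `x`. -/
theorem prod_sub_smul_mem {S G : Type*} [CommRing S] [Group G] [MulSemiringAction G S]
    (x : S) (H : Subgroup G) [Fintype H] (σ : G) (I : Ideal S)
    (hI : ∀ z : S, (∀ h ∈ H, h • z = z) → σ • z - z ∈ I) :
    ∏ h : H, (x - (σ * h) • x) ∈ I := by
  set f := MulSemiringAction.charpoly H x with hf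
  have h1 : (σ • f).eval x = ∏ h : H, (x - (σ * h) • x) := by
    rw [hf, MulSemiringAction.charpoly, Finset.smul_prod', Polynomial.eval_prod]
    refine Finset.prod_congr rfl fun h _ => ?_
    rw [smul_sub, Polynomial.smul_X, Polynomial.smul_C]
    simp [mul_smul, Subgroup.smul_def]
  have h2 : f.eval x = 0 := MulSemiringAction.eval_charpoly H x
  rw [← h1, ← sub_zero ((σ • f).eval x), ← h2, ← Polynomial.eval_sub, Polynomial.eval_eq_sum]
  refine Ideal.sum_mem _ fun i _ => Ideal.mul_mem_right _ _ ?_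
  rw [Polynomial.coeff_sub, Polynomial.coeff_smul]
  exact hI _ fun h hh => MulSemiringAction.smul_coeff_charpoly x i (⟨h, hh⟩ : H)

/-! ### Discrete valuations -/

theorem dvrValuation_algebraMap_le_iff {R K : Type*} [CommRing R] [IsDomain R]
    [IsDiscreteValuationRing R] [Field K] [Algebra R K] [IsFractionRing R K] (x : R) (n : ℕ) :
    dvrValuation R K (algebraMap R K x) ≤ WithZero.exp (-(n : ℤ)) ↔
      x ∈ IsLocalRing.maximalIdeal R ^ n := by
  rw [dvrValuation, IsDedekindDomain.HeightOneSpectrum.valuation_of_algebraMap,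
    IsDedekindDomain.HeightOneSpectrum.intValuation_le_pow_iff_mem]
  rfl

theorem dvrValuation_le_one_iff {R K : Type*} [CommRing R] [IsDomain R]
    [IsDiscreteValuationRing R] [Field K] [Algebra R K] [IsFractionRing R K] (x : K) :
    dvrValuation R K x ≤ 1 ↔ ∃ r : R, algebraMap R K r = x := by
  refine ⟨IsDiscreteValuationRing.exists_lift_of_le_one, ?_⟩
  rintro ⟨r, rfl⟩
  exact IsDedekindDomain.HeightOneSpectrum.valuation_le_one _ r

theorem dvrValuation_irreducible {R K : Type*} [CommRing R] [IsDomain R]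
    [IsDiscreteValuationRing R] [Field K] [Algebra R K] [IsFractionRing R K] {π : R}
    (hπ : Irreducible π) : dvrValuation R K (algebraMap R K π) = WithZero.exp (-1) := by
  rw [dvrValuation, IsDedekindDomain.HeightOneSpectrum.valuation_of_algebraMap]
  exact IsDedekindDomain.HeightOneSpectrum.intValuation_singleton _ hπ.ne_zero hπ.maximalIdeal_eq

theorem exists_eq_exp {x : ℤᵐ⁰} (hx : x ≠ 0) : ∃ n : ℤ, x = WithZero.exp n :=
  ⟨WithZero.log x, (WithZero.exp_log hx).symm⟩

/-- A sum whose nonzero terms have pairwise distinct values has a value at least as large as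
that of each of its terms. -/
theorem Valuation.map_le_map_sum_of_injOn {F Γ ι : Type*} [Field F]
    [LinearOrderedCommGroupWithZero Γ] (v : Valuation F Γ) (s : Finset ι) (f : ι → F)
    (h : ∀ i ∈ s, ∀ j ∈ s, v (f i) ≠ 0 → v (f i) = v (f j) → i = j) {i : ι} (hi : i ∈ s) :
    v (f i) ≤ v (∑ i ∈ s, f i) := by
  classical
  obtain ⟨j, hj, hmax⟩ := s.exists_max_image (fun i => v (f i)) ⟨i, hi⟩
  by_cases h0 : v (f j) = 0
  · exact ((hmax i hi).trans h0.le).trans zero_le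
  rw [v.map_sum_eq_of_lt hj]
  · exact hmax i hi
  · intro k hk
    simp only [Finset.mem_sdiff, Finset.mem_singleton] at hk
    exact lt_of_le_of_ne (hmax k hk.1) fun he => hk.2 (h j hj k hk.1 h0 he.symm).symm

/-! ### Trivial residue field extensions -/

/-- The characteristic polynomial of `s` under `G` has coefficients in `R` and reduces to a power of
`X - s̄`. So the minimal polynomial of `s̄` over the residue field of `R`, being separable, is
`X - s̄`. -/
theorem residueField_algebraMap_surjective {R S G : Type*} [CommRing R] [IsLocalRing R]
    [PerfectField (IsLocalRing.ResidueField R)] [CommRing S] [IsLocalRing S] [Algebra R S]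
    [Algebra.IsIntegral R S] [IsLocalHom (algebraMap R S)] [Group G] [Fintype G]
    [MulSemiringAction G S] [Algebra.IsInvariant R S G]
    (h : ∀ (g : G) (s : S), g • s - s ∈ IsLocalRing.maximalIdeal S) :
    Function.Surjective (algebraMap (IsLocalRing.ResidueField R) (IsLocalRing.ResidueField S)) := by
  intro t
  obtain ⟨s, rfl⟩ := IsLocalRing.residue_surjective t
  set t := IsLocalRing.residue S s with ht
  obtain ⟨q, hq⟩ := (Polynomial.mem_lifts _).mp (Algebra.IsInvariant.charpoly_mem_lifts R S G s)
  have hmap : (q.map (IsLocalRing.residue R)).map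
      (algebraMap (IsLocalRing.ResidueField R) (IsLocalRing.ResidueField S)) =
      (Polynomial.X - Polynomial.C t) ^ Fintype.card G := by
    rw [Polynomial.map_map, show (algebraMap (IsLocalRing.ResidueField R)
      (IsLocalRing.ResidueField S)).comp (IsLocalRing.residue R) =
      (IsLocalRing.residue S).comp (algebraMap R S) from rfl, ← Polynomial.map_map, hq,
      MulSemiringAction.charpoly, Polynomial.map_prod]
    rw [← Finset.card_univ, ← Finset.prod_const]
    refine Finset.prod_congr rfl fun g _ => ?_
    have : IsLocalRing.residue S (g • s) = t := by
      rw [ht, ← sub_eq_zero, ← map_sub, IsLocalRing.residue_eq_zero_iff]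
      exact h g s
    simp [this]
  have hint : IsIntegral (IsLocalRing.ResidueField R) t :=
    ((Algebra.IsIntegral.isIntegral (R := R) s).map
      (IsScalarTower.toAlgHom R S (IsLocalRing.ResidueField S))).tower_top
  have hdvd : minpoly (IsLocalRing.ResidueField R) t ∣ q.map (IsLocalRing.residue R) := by
    refine minpoly.dvd _ _ ?_
    rw [Polynomial.aeval_def, ← Polynomial.eval_map, hmap]
    simp
  have hsep : (minpoly (IsLocalRing.ResidueField R) t).Separable :=
    PerfectField.separable_of_irreducible (minpoly.irreducible hint)
  have hdvd2 := Polynomial.map_dvd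
    (algebraMap (IsLocalRing.ResidueField R) (IsLocalRing.ResidueField S)) hdvd
  rw [hmap] at hdvd2
  have hdvd3 := (hsep.map.squarefree.dvd_pow_iff_dvd Fintype.card_ne_zero).mp hdvd2
  have hdeg := Polynomial.natDegree_le_of_dvd hdvd3 (Polynomial.X_sub_C_ne_zero t)
  rw [Polynomial.natDegree_map, Polynomial.natDegree_X_sub_C] at hdeg
  exact minpoly.mem_range_of_degree_eq_one _ t
    ((Polynomial.degree_eq_iff_natDegree_eq_of_pos one_pos).mpr
      (le_antisymm hdeg (minpoly.natDegree_pos hint)))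

/-- A totally ramified extension of discrete valuation rings is generated by any uniformizer. As the
residue extension is trivial, `S = R[π] + π ^ j S` for all `j`; take `j` with `π ^ j S = 𝔪_R S` and
apply Nakayama's lemma. -/
theorem adjoin_irreducible_eq_top {R S : Type*} [CommRing R] [IsDomain R]
    [IsDiscreteValuationRing R] [CommRing S] [IsDomain S] [IsDiscreteValuationRing S]
    [Algebra R S] [Module.Finite R S] [FaithfulSMul R S] [IsLocalHom (algebraMap R S)]
    (hres : Function.Surjective
      (algebraMap (IsLocalRing.ResidueField R) (IsLocalRing.ResidueField S)))
    {π : S} (hπ : Irreducible π) : Algebra.adjoin R {π} = ⊤ := by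
  have hpow (j : ℕ) (s : S) : ∃ a ∈ Algebra.adjoin R {π}, ∃ b, s = a + π ^ j * b := by
    induction j generalizing s with
    | zero => exact ⟨0, zero_mem _, s, by simp⟩
    | succ j ih =>
      obtain ⟨r, hr⟩ := hres (IsLocalRing.residue S s)
      obtain ⟨r, rfl⟩ := IsLocalRing.residue_surjective r
      have hr' : IsLocalRing.residue S (s - algebraMap R S r) = 0 := by
        rw [map_sub, ← hr]; exact sub_self _
      rw [IsLocalRing.residue_eq_zero_iff, hπ.maximalIdeal_eq, Ideal.mem_span_singleton] at hr'
      obtain ⟨s', hs'⟩ := hr'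
      obtain ⟨a, ha, b, rfl⟩ := ih s'
      refine ⟨algebraMap R S r + π * a, add_mem (Subalgebra.algebraMap_mem _ _)
        (mul_mem (Algebra.self_mem_adjoin_singleton R π) ha), b, ?_⟩
      linear_combination hs'
  have hne : (IsLocalRing.maximalIdeal R).map (algebraMap R S) ≠ ⊥ := by
    rw [Ne, Ideal.map_eq_bot_iff_of_injective (FaithfulSMul.algebraMap_injective R S)]
    exact IsDiscreteValuationRing.not_a_field R
  obtain ⟨e, he⟩ := IsDiscreteValuationRing.ideal_eq_span_pow_irreducible hne hπ
  have hle : (⊤ : Submodule R S) ≤ Subalgebra.toSubmodule (Algebra.adjoin R {π}) := by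
    refine Submodule.le_of_le_smul_of_le_jacobson_bot Module.Finite.fg_top
      (IsLocalRing.maximalIdeal_le_jacobson _) fun s _ => ?_
    obtain ⟨a, ha, b, rfl⟩ := hpow e s
    refine Submodule.add_mem_sup ha ?_
    rw [Ideal.smul_top_eq_map, he]
    exact Ideal.mul_mem_right _ _ (Ideal.mem_span_singleton_self _)
  exact top_le_iff.mp fun s _ => hle trivial

/-- If the residue extension is trivial, the ramification index is the degree. -/
theorem dvrValuation_algebraMap_eq_pow {R S K E : Type*} [CommRing R] [IsDomain R]
    [IsDiscreteValuationRing R] [CommRing S] [IsDomain S] [IsDiscreteValuationRing S]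
    [Algebra R S] [Module.Finite R S] [FaithfulSMul R S] [IsLocalHom (algebraMap R S)]
    [Field K] [Algebra R K] [IsFractionRing R K] [Field E] [Algebra S E] [IsFractionRing S E]
    [Algebra K E] [Algebra R E] [IsScalarTower R S E] [IsScalarTower R K E]
    (hres : Function.Surjective
      (algebraMap (IsLocalRing.ResidueField R) (IsLocalRing.ResidueField S))) (β : K) :
    dvrValuation S E (algebraMap K E β) = dvrValuation R K β ^ Module.finrank K E := by
  have : Module.IsTorsionFree R S := inferInstance
  have hover : (IsLocalRing.maximalIdeal S).LiesOver (IsLocalRing.maximalIdeal R) := inferInstance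
  have hset : (IsLocalRing.maximalIdeal R).primesOver S = {IsLocalRing.maximalIdeal S} :=
    IsLocalRing.primesOver_eq S (IsDiscreteValuationRing.not_a_field R)
  let _ : Unique ((IsLocalRing.maximalIdeal R).primesOver S) := by rw [hset]; infer_instance
  have h0 := Ideal.sum_ramification_inertia_eq_finrank (IsLocalRing.maximalIdeal R) (S := S)
  rw [Fintype.sum_unique, show ((default : (IsLocalRing.maximalIdeal R).primesOver S) : Ideal S) =
    IsLocalRing.maximalIdeal S from hset.le (Subtype.property _)] at h0
  have h1 : (IsLocalRing.maximalIdeal R).ramificationIdx' (IsLocalRing.maximalIdeal S) *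
    (IsLocalRing.maximalIdeal R).inertiaDeg' (IsLocalRing.maximalIdeal S) =
      Module.finrank K E := by
    rw [Ideal.ramificationIdx'_eq_ramificationIdx _ _ (IsDiscreteValuationRing.not_a_field R),
      Ideal.inertiaDeg'_eq_inertiaDeg, h0, ← IsFractionRing.finrank_eq R K S E]
  have h2 : (IsLocalRing.maximalIdeal R).inertiaDeg' (IsLocalRing.maximalIdeal S) = 1 := by
    rw [Ideal.inertiaDeg'_algebraMap]
    change Module.finrank (IsLocalRing.ResidueField R) (IsLocalRing.ResidueField S) = 1
    exact Subalgebra.bot_eq_top_iff_finrank_eq_one.mp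
      (Algebra.surjective_algebraMap_iff.mp hres).symm
  rw [h2, mul_one] at h1
  rw [← h1]
  have : (IsDiscreteValuationRing.maximalIdeal S).asIdeal.LiesOver
    (IsDiscreteValuationRing.maximalIdeal R).asIdeal := hover
  exact (IsDedekindDomain.HeightOneSpectrum.valuation_liesOver E _ _ β).symm

/-! ### Artin–Schreier extensions -/

/-- Additive Hilbert 90 for a character with values in `𝔽_p`: if `θ` has trace `1`, then
`α = -∑ χ(τ) τ(θ)` satisfies `τ α = α + χ(τ)`. -/
theorem exists_artinSchreier_generator {K E : Type*} [Field K] [Field E] [Algebra K E]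
    [FiniteDimensional K E] [IsGalois K E] (p : ℕ) [Fact p.Prime] [CharP E p]
    (χ : Gal(E/K) →* Multiplicative (ZMod p)) :
    ∃ (α : E) (β : K), algebraMap K E β = α ^ p - α ∧
      ∀ τ : Gal(E/K), τ α = α + ZMod.castHom dvd_rfl E (χ τ).toAdd := by
  obtain ⟨θ, hθ⟩ := Algebra.trace_surjective K E 1
  have hsum : ∑ τ : Gal(E/K), τ θ = 1 := by
    rw [← trace_eq_sum_automorphisms, hθ, map_one]
  set c : Gal(E/K) → E := fun τ => ZMod.castHom dvd_rfl E (χ τ).toAdd with hc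
  have hcfix (σ τ : Gal(E/K)) : σ (c τ) = c τ := by
    exact RingHom.congr_fun (RingHom.ext_zmod ((σ : E →+* E).comp (ZMod.castHom dvd_rfl E))
      (ZMod.castHom dvd_rfl E)) _
  have hmul (σ τ : Gal(E/K)) : c (σ * τ) = c σ + c τ := by simp [hc, -ZMod.castHom_apply]
  have hα (σ : Gal(E/K)) : σ (-∑ τ, c τ * τ θ) = -∑ τ, c τ * τ θ + c σ := by
    rw [map_neg, map_sum, ← Equiv.sum_comp (Equiv.mulLeft σ) (fun τ => c τ * τ θ)]
    have : c σ = ∑ τ, c σ * (σ * τ) θ := by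
      have h1 : ∑ τ, (σ * τ) θ = 1 :=
        (Equiv.sum_comp (Equiv.mulLeft σ) (fun τ => τ θ)).trans hsum
      rw [← Finset.mul_sum, h1, mul_one]
    rw [this]
    rw [neg_add_eq_sub, ← Finset.sum_sub_distrib, ← Finset.sum_neg_distrib]
    refine Finset.sum_congr rfl fun τ _ => ?_
    simp only [Equiv.coe_mulLeft, hmul, map_mul, hcfix, AlgEquiv.mul_apply]
    ring
  set α := -∑ τ, c τ * τ θ with hαdef
  have hfix (σ : Gal(E/K)) : σ (α ^ p - α) = α ^ p - α := by
    have hcp : c σ ^ p = c σ := by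
      rw [hc]
      simp only [← map_pow, ZMod.pow_card]
    rw [map_sub, map_pow, hα, add_pow_char, hcp]
    ring
  obtain ⟨β, hβ⟩ := (IsGalois.mem_range_algebraMap_iff_fixed _).mpr hfix
  exact ⟨α, β, hβ, hα⟩

/-- The character of the Galois group attached to an Artin–Schreier generator. -/
theorem exists_artinSchreier_character {K E : Type*} [Field K] [Field E] [Algebra K E]
    (p : ℕ) [Fact p.Prime] [CharP E p] {α : E} {β : K} (hβ : algebraMap K E β = α ^ p - α) :
    ∃ χ : Gal(E/K) →* Multiplicative (ZMod p),
      ∀ τ : Gal(E/K), τ α = α + ZMod.castHom dvd_rfl E (χ τ).toAdd := by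
  have h (τ : Gal(E/K)) : ∃ c : ZMod p, ZMod.castHom dvd_rfl E c = τ α - α := by
    have h1 : (τ α - α) ^ p = τ α - α := by
      have h2 : τ (α ^ p - α) = α ^ p - α := by rw [← hβ, AlgEquiv.commutes]
      rw [map_sub, map_pow] at h2
      rw [sub_pow_char]
      linear_combination h2
    rw [← Subfield.mem_bot_iff_pow_eq_self, ← ZMod.fieldRange_castHom_eq_bot p] at h1
    exact h1
  choose c hc using h
  have hcfix (σ : Gal(E/K)) (x : ZMod p) :
      σ (ZMod.castHom dvd_rfl E x) = ZMod.castHom dvd_rfl E x :=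
    RingHom.congr_fun (RingHom.ext_zmod ((σ : E →+* E).comp (ZMod.castHom dvd_rfl E))
      (ZMod.castHom dvd_rfl E)) _
  refine ⟨MonoidHom.mk' (fun τ => Multiplicative.ofAdd (c τ)) fun σ τ => ?_, fun τ => ?_⟩
  · rw [← ofAdd_add]
    congr 1
    apply (ZMod.castHom (dvd_refl p) E).injective
    have h1 := hcfix σ (c τ)
    rw [map_add, hc, hc, hc, AlgEquiv.mul_apply]
    rw [hc, map_sub] at h1
    linear_combination h1
  · simp [hc, -ZMod.castHom_apply]

theorem card_ker_mul_eq_card {G : Type*} [Group G] (p : ℕ) [Fact p.Prime]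
    {χ : G →* Multiplicative (ZMod p)} {σ : G} (hσ : χ σ ≠ 1) :
    Nat.card χ.ker * p = Nat.card G := by
  rw [← Subgroup.card_mul_index χ.ker, Subgroup.index_ker]
  have : Fact (Nat.card (Multiplicative (ZMod p))).Prime := by simpa using ‹Fact p.Prime›
  rcases Subgroup.eq_bot_or_eq_top_of_prime_card χ.range with h | h
  · exact absurd (Subgroup.mem_bot.mp (h ▸ ⟨σ, rfl⟩ : χ σ ∈ (⊥ : Subgroup _))) hσ
  · rw [h]; simp

theorem fixingSubgroup_adjoin_simple_eq_ker {K E : Type*} [Field K] [Field E] [Algebra K E]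
    (p : ℕ) [Fact p.Prime] [CharP E p] {α : E} {χ : Gal(E/K) →* Multiplicative (ZMod p)}
    (hχ : ∀ τ : Gal(E/K), τ α = α + ZMod.castHom dvd_rfl E (χ τ).toAdd) :
    (IntermediateField.adjoin K {α}).fixingSubgroup = χ.ker := by
  ext τ
  have h1 : τ ∈ χ.ker ↔ τ α = α := by
    rw [hχ, add_eq_left, map_eq_zero, MonoidHom.mem_ker, toAdd_eq_zero]
  rw [h1, ← Subgroup.zpowers_le, ← IntermediateField.le_iff_le,
    IntermediateField.adjoin_simple_le_iff, IntermediateField.mem_fixedField_iff]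
  refine ⟨fun h => h τ (Subgroup.mem_zpowers τ), fun h => ?_⟩
  have : Subgroup.zpowers τ ≤ MulAction.stabilizer Gal(E/K) α := Subgroup.zpowers_le.mpr h
  exact fun f hf => this hf

/-- If the residue field is perfect, a pole whose order is divisible by `p` can be reduced by
subtracting a suitable `c ^ p - c`. -/
theorem exists_sub_artinSchreier_reduced {R K : Type*} [CommRing R] [IsDomain R]
    [IsDiscreteValuationRing R] [Field K] [Algebra R K] [IsFractionRing R K]
    [PerfectField (IsLocalRing.ResidueField R)] (p : ℕ) [Fact p.Prime] [CharP R p] [CharP K p]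
    (β : K) :
    ∃ c : K, dvrValuation R K (β - (c ^ p - c)) ≤ 1 ∨
      ∃ m : ℕ, ¬ p ∣ m ∧ dvrValuation R K (β - (c ^ p - c)) = WithZero.exp (m : ℤ) := by
  have hp : p.Prime := Fact.out
  set w := dvrValuation R K with hw
  -- Induction on a bound `N` for the order of the pole.
  suffices H : ∀ (N : ℕ) (β : K), w β ≤ WithZero.exp (N : ℤ) → ∃ c : K, w (β - (c ^ p - c)) ≤ 1 ∨
      ∃ m : ℕ, ¬ p ∣ m ∧ w (β - (c ^ p - c)) = WithZero.exp (m : ℤ) by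
    refine H (WithZero.log (w β)).toNat β ?_
    by_cases h0 : w β = 0
    · simp [h0]
    · rw [← WithZero.log_le_iff_le_exp h0]
      exact Int.self_le_toNat _
  intro N
  induction N with
  | zero => exact fun β h => ⟨0, Or.inl (by simpa [hp.ne_zero] using h)⟩
  | succ N ih =>
    intro β hβ
    by_cases hN : w β ≤ WithZero.exp (N : ℤ)
    · exact ih β hN
    have h0 : w β ≠ 0 := by rintro h; simp [h] at hN
    have hβ' : w β = WithZero.exp ((N + 1 : ℕ) : ℤ) := by
      obtain ⟨n, hn⟩ := exists_eq_exp h0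
      rw [hn] at hβ hN ⊢
      rw [WithZero.exp_le_exp] at hβ hN
      congr 1
      push_cast at hβ ⊢
      omega
    by_cases hpN : p ∣ N + 1
    · obtain ⟨m, hm⟩ := hpN
      obtain ⟨π, hπ⟩ := IsDiscreteValuationRing.exists_irreducible R
      set t := algebraMap R K π with ht
      have hwt : w t = WithZero.exp (-1) := dvrValuation_irreducible hπ
      have ht0 : t ≠ 0 := (w.ne_zero_iff).mp (hwt ▸ WithZero.exp_ne_zero)
      obtain ⟨u, hu⟩ := (dvrValuation_le_one_iff (R := R) (β * t ^ (p * m))).mp (by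
        change w _ ≤ 1
        rw [map_mul, map_pow, hβ', hwt, hm, ← WithZero.exp_nsmul, ← WithZero.exp_add]
        simp)
      have : CharP (IsLocalRing.ResidueField R) p :=
        (CharP.charP_iff_prime_eq_zero hp).mpr (by
          rw [← map_natCast (IsLocalRing.residue R), CharP.cast_eq_zero, map_zero])
      obtain ⟨x, hx⟩ : ∃ x : R, IsLocalRing.residue R (u - x ^ p) = 0 := by
        obtain ⟨y, hy⟩ := (PerfectField.toPerfectRing p).bijective_frobenius.2
          (IsLocalRing.residue R u)
        obtain ⟨x, rfl⟩ := IsLocalRing.residue_surjective y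
        exact ⟨x, by rw [map_sub, map_pow, ← hy]; exact sub_self _⟩
      have hx' : w (algebraMap R K (u - x ^ p)) ≤ WithZero.exp (-1) := by
        have := (dvrValuation_algebraMap_le_iff (K := K) (u - x ^ p) 1).mpr (by
          rw [pow_one]; exact (IsLocalRing.residue_eq_zero_iff _).mp hx)
        simpa using this
      -- `d ^ p` has the same leading term as `β`, and `d` itself has a pole of smaller order.
      set d := algebraMap R K x / t ^ m with hd
      have hwd : w d ≤ WithZero.exp (m : ℤ) := by
        rw [hd, map_div₀, map_pow, hwt, ← WithZero.exp_nsmul, div_eq_mul_inv, ← WithZero.exp_neg]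
        have : w (algebraMap R K x) ≤ 1 := (dvrValuation_le_one_iff _).mpr ⟨x, rfl⟩
        simpa using mul_le_mul_left this (WithZero.exp (m : ℤ))
      have hsub : w (β - d ^ p) ≤ WithZero.exp (N : ℤ) := by
        have : β - d ^ p = algebraMap R K (u - x ^ p) / t ^ (p * m) := by
          rw [map_sub, hu, map_pow, hd, sub_div, mul_div_cancel_right₀ _ (pow_ne_zero _ ht0),
            div_pow, ← pow_mul, mul_comm m p]
        rw [this, map_div₀, map_pow, hwt, ← WithZero.exp_nsmul, div_eq_mul_inv, ← WithZero.exp_neg]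
        refine (mul_le_mul_left hx' _).trans ?_
        rw [← WithZero.exp_add, WithZero.exp_le_exp]
        simp only [nsmul_eq_mul]
        have : ((p * m : ℕ) : ℤ) = N + 1 := by exact_mod_cast hm.symm
        rw [this]
        omega
      have hmN : m ≤ N := by
        have := hp.two_le
        nlinarith
      obtain ⟨c, hc⟩ := ih (β - d ^ p + d) (w.map_add_le hsub
        (hwd.trans (WithZero.exp_le_exp.mpr (by exact_mod_cast hmN))))
      refine ⟨c + d, ?_⟩
      have : β - ((c + d) ^ p - (c + d)) = β - d ^ p + d - (c ^ p - c) := by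
        rw [add_pow_char]; ring
      rwa [this]
    · exact ⟨0, Or.inr ⟨N + 1, hpN, by simpa [hp.ne_zero] using hβ'⟩⟩

/-! ### Valuations on Artin–Schreier extensions -/

theorem valuation_artinSchreier_generator {E : Type*} [Field E] (v : Valuation E ℤᵐ⁰) {p : ℕ}
    (hp : 1 < p) {n : ℤ} (hn : 0 < n) {α : E} (h : v (α ^ p - α) = WithZero.exp (p * n)) :
    v α = WithZero.exp n := by
  have h1 : 1 < v α := by
    by_contra! hle
    have : v (α ^ p - α) ≤ 1 := v.map_sub_le (by rw [map_pow]; exact pow_le_one' hle p) hle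
    rw [h, ← WithZero.exp_zero, WithZero.exp_le_exp] at this
    have : (0 : ℤ) < p * n := by positivity
    omega
  have h2 : v (α ^ p - α) = v α ^ p := by
    rw [v.map_sub_eq_of_lt_left, map_pow]
    rw [map_pow]
    exact lt_self_pow₀ h1 hp
  rw [h2] at h
  obtain ⟨k, hk⟩ := exists_eq_exp (x := v α) (zero_lt_one.trans h1).ne'
  rw [hk, ← WithZero.exp_nsmul, WithZero.exp_inj, nsmul_eq_mul] at h
  rw [hk, mul_left_cancel₀ (by positivity) h]

theorem Valuation.map_add_pow_sub_pow_le {E : Type*} [Field E] (v : Valuation E ℤᵐ⁰) {α c : E}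
    (hα : 1 ≤ v α) (hc : v c ≤ 1) (i : ℕ) :
    v ((α + c) ^ (i + 1) - α ^ (i + 1)) ≤ v α ^ i := by
  have hαc : v (α + c) ≤ v α := v.map_add_le le_rfl (hc.trans hα)
  induction i with
  | zero => simpa using hc
  | succ i ih =>
    have : (α + c) ^ (i + 1 + 1) - α ^ (i + 1 + 1) =
      (α + c) * ((α + c) ^ (i + 1) - α ^ (i + 1)) + c * α ^ (i + 1) := by ring
    rw [this]
    refine v.map_add_le ?_ ?_
    · rw [map_mul, pow_succ' (v α)]
      exact mul_le_mul' hαc ih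
    · rw [map_mul, map_pow]
      exact mul_le_of_le_one_left' hc

/-- Write `z = ∑ cᵢ αⁱ` with `i < p`. As `m` is prime to `p`, the nonzero terms have
distinct values, so each is integral, and those with `i ≠ 0` are not units, hence have order at
least `q`. Replacing `α` by `α + c` changes `αⁱ` by an element whose order exceeds that of `αⁱ` by
at least `m q`. -/
theorem valuation_sub_le_of_mem_adjoin_artinSchreier {K E : Type*} [Field K] [Field E]
    [Algebra K E] (w : Valuation K ℤᵐ⁰) (v : Valuation E ℤᵐ⁰) {p q : ℕ} (hp : p.Prime)
    (hq : 0 < q) (hvw : ∀ x : K, v (algebraMap K E x) = w x ^ (p * q))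
    {α : E} {β : K} (hβ : algebraMap K E β = α ^ p - α) {m : ℕ} (hm : ¬ p ∣ m)
    (hα : v α = WithZero.exp ((m * q : ℕ) : ℤ)) {z : E} (hz : z ∈ IntermediateField.adjoin K {α})
    (hvz : v z ≤ 1) {σ : E →ₐ[K] E} {c : E} (hσ : σ α = α + c) (hc : v c ≤ 1) :
    v (σ z - z) ≤ WithZero.exp (-(((m + 1) * q : ℕ) : ℤ)) := by
  set P : Polynomial K := Polynomial.X ^ p - (Polynomial.X + Polynomial.C β) with hP
  have hPmonic : P.Monic := by
    refine Polynomial.monic_X_pow_sub ?_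
    rw [Polynomial.degree_X_add_C]
    exact_mod_cast hp.one_lt
  have hPα : Polynomial.aeval α P = 0 := by simp [hP, hβ]
  have hP1 : P ≠ 1 := by
    intro h
    simp [h] at hPα
  have hPdeg : P.natDegree ≤ p := by
    rw [hP]
    compute_degree!
    exact hp.one_lt.le
  have hαint : IsIntegral K α := ⟨P, hPmonic, hPα⟩
  obtain ⟨g, hg, rfl⟩ : ∃ g : Polynomial K, g.natDegree < p ∧ Polynomial.aeval α g = z := by
    rw [← IntermediateField.mem_toSubalgebra,
      IntermediateField.adjoin_simple_toSubalgebra_of_isAlgebraic hαint.isAlgebraic,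
      Algebra.adjoin_singleton_eq_range_aeval] at hz
    obtain ⟨g, rfl⟩ := hz
    exact ⟨g %ₘ P, (Polynomial.natDegree_modByMonic_lt g hPmonic hP1).trans_le hPdeg,
      Polynomial.aeval_modByMonic_eq_self_of_root hPα⟩
  rw [Polynomial.aeval_eq_sum_range' hg] at hvz ⊢
  simp only [Algebra.smul_def] at hvz ⊢
  -- Modulo `p q`, the exponent of the term of index `i` is `i m q`.
  have hterm (i : ℕ) (hi : g.coeff i ≠ 0) : ∃ n : ℤ, w (g.coeff i) = WithZero.exp n ∧
      v (algebraMap K E (g.coeff i) * α ^ i) = WithZero.exp ((p * n + i * m) * q) := by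
    obtain ⟨n, hn⟩ := exists_eq_exp (w.ne_zero_iff.mpr hi)
    refine ⟨n, hn, ?_⟩
    rw [map_mul, map_pow, hvw, hn, hα, ← WithZero.exp_nsmul, ← WithZero.exp_nsmul,
      ← WithZero.exp_add]
    congr 1
    simp only [nsmul_eq_mul]
    push_cast
    ring
  have hcoeff {i : ℕ} (h : v (algebraMap K E (g.coeff i) * α ^ i) ≠ 0) : g.coeff i ≠ 0 := by
    rintro h0; simp [h0] at h
  have hmZ : IsCoprime (m : ℤ) p :=
    Nat.isCoprime_iff_coprime.mpr ((hp.coprime_iff_not_dvd.mpr hm).symm)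
  have hle (i) (hi : i ∈ Finset.range p) : v (algebraMap K E (g.coeff i) * α ^ i) ≤ 1 := by
    refine (v.map_le_map_sum_of_injOn (Finset.range p) _ ?_ hi).trans hvz
    intro i hi j hj h0 hij
    obtain ⟨n, -, hn⟩ := hterm i (hcoeff h0)
    obtain ⟨n', -, hn'⟩ := hterm j (hcoeff (hij ▸ h0))
    rw [hn, hn', WithZero.exp_inj] at hij
    have h1 := mul_right_cancel₀ (by exact_mod_cast hq.ne') hij
    have h2 : (p : ℤ) ∣ (i - j) := hmZ.symm.dvd_of_dvd_mul_right (z := (m : ℤ))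
      ⟨n' - n, by linear_combination h1⟩
    rw [Finset.mem_range] at hi hj
    have := Int.eq_zero_of_abs_lt_dvd h2 (by rw [abs_lt]; omega)
    omega
  rw [map_sum, ← Finset.sum_sub_distrib]
  refine v.map_sum_le fun i hi => ?_
  simp only [map_mul, map_pow, AlgHom.commutes, hσ]
  rw [← mul_sub, map_mul]
  by_cases h0 : g.coeff i = 0
  · simp [h0]
  rcases i with _ | i
  · simp
  obtain ⟨n, hwn, hn⟩ := hterm _ h0
  have h1 := hle _ hi
  rw [hn, ← WithZero.exp_zero, WithZero.exp_le_exp] at h1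
  have h2 : p * n + (i + 1 : ℕ) * m ≠ 0 := by
    intro h2
    have h3 : (p : ℤ) ∣ (i + 1 : ℕ) := hmZ.symm.dvd_of_dvd_mul_right (z := (m : ℤ))
      ⟨-n, by linear_combination h2⟩
    have := Nat.le_of_dvd (by omega) (Int.natCast_dvd_natCast.mp h3)
    rw [Finset.mem_range] at hi
    omega
  have hqZ : (0 : ℤ) < q := by exact_mod_cast hq
  have h3 : p * n + (i + 1 : ℕ) * m ≤ -1 := by
    have : p * n + (i + 1 : ℕ) * m ≤ 0 := nonpos_of_mul_nonpos_left h1 hqZ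
    omega
  have hα1 : 1 ≤ v α := by
    rw [hα, ← WithZero.exp_zero, WithZero.exp_le_exp]; positivity
  refine (mul_le_mul_right (v.map_add_pow_sub_pow_le hα1 hc i) _).trans ?_
  rw [hvw, hwn, hα, ← WithZero.exp_nsmul, ← WithZero.exp_nsmul, ← WithZero.exp_add,
    WithZero.exp_le_exp]
  simp only [nsmul_eq_mul]
  push_cast at h3 ⊢
  nlinarith

/-! ### Characters of the wild ramification group -/

/-- If `G = G₁`, the residue class of `(g π - π) / π ^ 2` is a homomorphism to the additive group of
the residue field. This group is written multiplicatively. -/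
theorem exists_residue_character {S G : Type*} [CommRing S] [IsDomain S]
    [IsDiscreteValuationRing S] [Group G] [MulSemiringAction G S]
    (h : ∀ (g : G) (s : S), g • s - s ∈ IsLocalRing.maximalIdeal S ^ 2)
    {π : S} (hπ : Irreducible π) :
    ∃ a : G →* Multiplicative (IsLocalRing.ResidueField S), ∀ g, ∃ s : S,
      g • π - π = π ^ 2 * s ∧ a g = Multiplicative.ofAdd (IsLocalRing.residue S s) := by
  simp only [hπ.maximalIdeal_eq, Ideal.span_singleton_pow, Ideal.mem_span_singleton] at h
  choose b hb using h
  refine ⟨MonoidHom.mk' (fun g => Multiplicative.ofAdd (IsLocalRing.residue S (b g π)))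
    fun g g' => ?_, fun g => ⟨b g π, hb g π, rfl⟩⟩
  rw [← ofAdd_add, ← map_add]
  congr 1
  -- Here `b g s` denotes `(g • s - s) / π ^ 2`.
  have key : b (g * g') π = (b g' π + π ^ 2 * b g (b g' π)) * (1 + π * b g π) ^ 2 + b g π := by
    refine mul_left_cancel₀ (pow_ne_zero 2 hπ.ne_zero) ?_
    have h1 : g' • π = π + π ^ 2 * b g' π := by linear_combination hb g' π
    have h2 : g • π = π + π ^ 2 * b g π := by linear_combination hb g π
    have h3 : g • b g' π = b g' π + π ^ 2 * b g (b g' π) := by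
      linear_combination hb g (b g' π)
    rw [← hb, mul_smul, h1, smul_add, smul_mul', smul_pow', h2, h3]
    ring
  have hπ0 : IsLocalRing.residue S π = 0 := by
    rw [IsLocalRing.residue_eq_zero_iff, hπ.maximalIdeal_eq]
    exact Ideal.mem_span_singleton_self π
  rw [key]
  simp [hπ0, add_comm]

/-- The additive group of a field of characteristic `p` has enough characters with values in `𝔽_p`,
namely the `𝔽_p`-linear forms. -/
theorem exists_character_ne_one {F G : Type*} [Field F] (p : ℕ) [Fact p.Prime] [CharP F p]
    [Group G] (a : G →* Multiplicative F) {σ : G} (hσ : a σ ≠ 1) :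
    ∃ χ : G →* Multiplicative (ZMod p), χ σ ≠ 1 ∧ ∀ τ, χ τ ≠ 1 → a τ ≠ 1 := by
  let _ : Algebra (ZMod p) F := ZMod.algebra F p
  obtain ⟨f, hf⟩ : ∃ f : Module.Dual (ZMod p) F, f (a σ).toAdd ≠ 0 := by
    by_contra! h
    exact hσ (toAdd_eq_zero.mp ((Module.forall_dual_apply_eq_zero_iff (ZMod p) _).mp h))
  refine ⟨f.toAddMonoidHom.toMultiplicative.comp a, fun h => hf (ofAdd_eq_one.mp h),
    fun τ hτ h => hτ ?_⟩
  rw [MonoidHom.comp_apply, h, map_one]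

theorem Valuation.map_eq_one_of_pow_eq {E : Type*} [Field E] (v : Valuation E ℤᵐ⁰) {p : ℕ}
    (hp : 1 < p) {c : E} (hc0 : c ≠ 0) (hc : c ^ p = c) : v c = 1 := by
  obtain ⟨n, hn⟩ := exists_eq_exp (v.ne_zero_iff.mpr hc0)
  have h := congrArg v hc
  rw [map_pow, hn, ← WithZero.exp_nsmul, WithZero.exp_inj, nsmul_eq_mul] at h
  have hpZ : (1 : ℤ) < p := by exact_mod_cast hp
  have : ((p : ℤ) - 1) * n = 0 := by linear_combination h
  rcases mul_eq_zero.mp this with h | h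
  · omega
  · rw [hn, h, WithZero.exp_zero]

theorem castHom_pow_eq {E : Type*} [CommRing E] (p : ℕ) [Fact p.Prime] [CharP E p] (x : ZMod p) :
    ZMod.castHom dvd_rfl E x ^ p = ZMod.castHom dvd_rfl E x := by
  rw [← map_pow, ZMod.pow_card]

theorem Valuation.map_castHom_le_one {E : Type*} [Field E] (v : Valuation E ℤᵐ⁰) (p : ℕ)
    [Fact p.Prime] [CharP E p] (x : ZMod p) : v (ZMod.castHom dvd_rfl E x) ≤ 1 := by
  by_cases h : ZMod.castHom (dvd_refl p) E x = 0
  · rw [h, map_zero]; exact zero_le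
  · exact (v.map_eq_one_of_pow_eq (Fact.out : p.Prime).one_lt h (castHom_pow_eq p x)).le

theorem smul_injective_of_adjoin_eq_top {R S K E : Type*} [CommRing R] [CommRing S]
    [Algebra R S] [Field K] [Field E] [Algebra S E] [IsFractionRing S E] [Algebra K E]
    [MulSemiringAction Gal(E/K) S] [SMulDistribClass Gal(E/K) S E] [SMulCommClass Gal(E/K) R S]
    {π : S}
    (hgen : Algebra.adjoin R {π} = ⊤) :
    Function.Injective (fun σ : Gal(E/K) => σ • π) := by
  intro σ τ h
  have h1 : MulSemiringAction.toAlgHom R S σ = MulSemiringAction.toAlgHom R S τ :=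
    AlgHom.ext_of_adjoin_eq_top hgen (by rintro _ rfl; exact h)
  have h2 (s : S) : σ (algebraMap S E s) = τ (algebraMap S E s) := by
    have := congrArg (algebraMap S E) (AlgHom.congr_fun h1 s)
    simpa [algebraMap.smul'] using this
  ext x
  obtain ⟨a, b, -, rfl⟩ := IsFractionRing.div_surjective (A := S) x
  rw [map_div₀, map_div₀, h2, h2]

/-! ### Ramification in Artin–Schreier extensions -/

section ArtinSchreier

variable {R S K E : Type*} [CommRing R] [IsDomain R] [IsDiscreteValuationRing R]
  [CommRing S] [IsDomain S] [IsDiscreteValuationRing S]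
  [Field K] [Algebra R K] [IsFractionRing R K] [Field E] [Algebra S E] [IsFractionRing S E]
  [Algebra K E] [FiniteDimensional K E] [IsGalois K E]
  [MulSemiringAction Gal(E/K) S] [SMulDistribClass Gal(E/K) S E]
  (p : ℕ) [Fact p.Prime] [CharP E p]

/-- If the automorphisms that move an Artin–Schreier generator `α` with pole order `m` prime to `p`
all have ramification jump `1`, then `m ≤ 1`. -/
theorem le_one_of_artinSchreier
    (hvw : ∀ x : K, dvrValuation S E (algebraMap K E x) = dvrValuation R K x ^ Module.finrank K E)
    {α : E} {β : K} (hβ : algebraMap K E β = α ^ p - α)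
    {χ : Gal(E/K) →* Multiplicative (ZMod p)}
    (hχ : ∀ τ : Gal(E/K), τ α = α + ZMod.castHom dvd_rfl E (χ τ).toAdd)
    {σ : Gal(E/K)} (hσ : χ σ ≠ 1) {m : ℕ} (hm : ¬ p ∣ m)
    (hwβ : dvrValuation R K β = WithZero.exp (m : ℤ)) {π : S}
    (hπ : ∀ τ : Gal(E/K), χ τ ≠ 1 →
      dvrValuation S E (algebraMap S E (π - τ • π)) = WithZero.exp (-2)) : m ≤ 1 := by
  have hp : p.Prime := Fact.out
  -- The ramification index is `p q`, where `q` is the order of the kernel `H` of `χ`.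
  have hcard := card_ker_mul_eq_card p hσ
  set q := Nat.card χ.ker with hq
  have hq0 : 0 < q := Nat.card_pos
  rw [IsGalois.card_aut_eq_finrank, mul_comm] at hcard
  rw [← hcard] at hvw
  have hm0 : 0 < m := Nat.pos_of_ne_zero (by rintro rfl; exact hm (dvd_zero p))
  have hvα : dvrValuation S E α = WithZero.exp ((m * q : ℕ) : ℤ) := by
    refine valuation_artinSchreier_generator _ hp.one_lt (by positivity) ?_
    rw [← hβ, hvw, hwβ, ← WithZero.exp_nsmul, nsmul_eq_mul]
    congr 1
    push_cast
    ring
  have : Fintype χ.ker := Fintype.ofFinite _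
  -- The value of the product is `2 q`, and it is at least `(m + 1) q`.
  have hmem : ∏ h : χ.ker, (π - (σ * h) • π) ∈ IsLocalRing.maximalIdeal S ^ ((m + 1) * q) := by
    refine prod_sub_smul_mem π χ.ker σ _ fun z hz => ?_
    rw [← dvrValuation_algebraMap_le_iff (K := E), map_sub, algebraMap.smul']
    refine valuation_sub_le_of_mem_adjoin_artinSchreier (dvrValuation R K) (dvrValuation S E) hp
      hq0 hvw hβ hm hvα ?_ ((dvrValuation_le_one_iff _).mpr ⟨z, rfl⟩) (σ := (σ : E →ₐ[K] E))
      (hχ σ) (Valuation.map_castHom_le_one _ p _)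
    rw [← IsGalois.fixedField_fixingSubgroup (IntermediateField.adjoin K {α}),
      fixingSubgroup_adjoin_simple_eq_ker p hχ, IntermediateField.mem_fixedField_iff]
    intro h hh
    have := congrArg (algebraMap S E) (hz h hh)
    rwa [algebraMap.smul'] at this
  have hterm (h : χ.ker) :
      dvrValuation S E (algebraMap S E (π - (σ * h) • π)) = WithZero.exp (-2) :=
    hπ (σ * h) (by rwa [map_mul, MonoidHom.mem_ker.mp h.2, mul_one])
  rw [← dvrValuation_algebraMap_le_iff (K := E), map_prod, map_prod,
    Finset.prod_congr rfl fun h _ => hterm h, Finset.prod_const,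
    Finset.card_univ, ← Nat.card_eq_fintype_card, ← WithZero.exp_nsmul, WithZero.exp_le_exp] at hmem
  simp only [nsmul_eq_mul, ← hq] at hmem
  push_cast at hmem
  have hq0' : (0 : ℤ) < q := by exact_mod_cast hq0
  have : (m : ℤ) ≤ 1 := by nlinarith
  exact_mod_cast this

/-- If `G = G₁` and `v_R (α ^ p - α) = -1`, then an automorphism in `G₂` fixes `α`. -/
theorem apply_eq_of_mem_pow_three [Algebra R S] [SMulCommClass Gal(E/K) R S]
    (hvw : ∀ x : K, dvrValuation S E (algebraMap K E x) = dvrValuation R K x ^ Module.finrank K E)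
    {α : E} {β : K} (hβ : algebraMap K E β = α ^ p - α)
    (hwβ : dvrValuation R K β = WithZero.exp 1) {π : S} (hgen : Algebra.adjoin R {π} = ⊤)
    (hπ : ∀ τ : Gal(E/K), π - τ • π ∈ IsLocalRing.maximalIdeal S ^ 2)
    {σ : Gal(E/K)} (hσ : π - σ • π ∈ IsLocalRing.maximalIdeal S ^ 3) : σ α = α := by
  have hp : p.Prime := Fact.out
  obtain ⟨χ, hχ⟩ := exists_artinSchreier_character (K := K) p hβ
  by_contra hne
  set c := ZMod.castHom dvd_rfl E (χ σ).toAdd with hc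
  have hc0 : c ≠ 0 := fun h => hne (by rw [hχ, ← hc, h, add_zero])
  have hχσ : χ σ ≠ 1 := fun h => hc0 (by rw [hc, h, toAdd_one, map_zero])
  have hcard := card_ker_mul_eq_card p hχσ
  set q := Nat.card χ.ker with hq
  have hq0 : 0 < q := Nat.card_pos
  rw [IsGalois.card_aut_eq_finrank, mul_comm] at hcard
  rw [← hcard] at hvw
  set v := dvrValuation S E with hv
  have hvα : v α = WithZero.exp (q : ℤ) := by
    refine valuation_artinSchreier_generator _ hp.one_lt (by positivity) ?_
    rw [← hβ, hvw, hwβ, ← WithZero.exp_nsmul, nsmul_eq_mul]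
    congr 1
    push_cast
    ring
  have hvc : v c = 1 := v.map_eq_one_of_pow_eq hp.one_lt hc0 (castHom_pow_eq p _)
  have hvαc : v (α + c) = WithZero.exp (q : ℤ) := by
    rw [v.map_add_eq_of_lt_left, hvα]
    rw [hvc, hvα, ← WithZero.exp_zero, WithZero.exp_lt_exp]
    exact_mod_cast hq0
  have hα0 : α ≠ 0 := v.ne_zero_iff.mp (hvα ▸ WithZero.exp_ne_zero)
  have hαc0 : α + c ≠ 0 := v.ne_zero_iff.mp (hvαc ▸ WithZero.exp_ne_zero)
  -- `y - σ y` has value `2 q`, yet it is divisible by a product of value at least `2 q + 1`.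
  obtain ⟨y, hy⟩ := (dvrValuation_le_one_iff (R := S) α⁻¹).mp (by
    rw [map_inv₀, ← hv, hvα, ← WithZero.exp_neg, ← WithZero.exp_zero, WithZero.exp_le_exp]
    omega)
  have : Fintype χ.ker := Fintype.ofFinite _
  have hdvd : ∏ h : χ.ker, (π - (σ * h) • π) ∣ y - σ • y := by
    refine prod_sub_smul_dvd_sub (R := R) (hgen ▸ Algebra.mem_top) Finset.univ
      (fun h : χ.ker => σ * (h : Gal(E/K))) (fun h _ h' _ hh => ?_) fun h _ => ?_
    · exact Subtype.ext (mul_left_cancel (smul_injective_of_adjoin_eq_top hgen hh))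
    · rw [mul_smul]
      congr 1
      apply IsFractionRing.injective S E
      rw [algebraMap.smul', hy, AlgEquiv.smul_def, map_inv₀, hχ, MonoidHom.mem_ker.mp h.2,
        toAdd_one, map_zero, add_zero]
  have hprod : ∏ h : χ.ker, (π - (σ * h) • π) ∈ IsLocalRing.maximalIdeal S ^ (2 * q + 1) := by
    classical
    rw [← Finset.mul_prod_erase Finset.univ _ (Finset.mem_univ 1)]
    have h1 : ∏ h ∈ Finset.univ.erase (1 : χ.ker), (π - (σ * h) • π) ∈
        ∏ h ∈ Finset.univ.erase (1 : χ.ker), IsLocalRing.maximalIdeal S ^ 2 :=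
      Ideal.prod_mem_prod fun h _ => hπ _
    rw [Finset.prod_const, Finset.card_erase_of_mem (Finset.mem_univ _), Finset.card_univ,
      ← Nat.card_eq_fintype_card, ← hq, ← pow_mul] at h1
    have h2 := Ideal.mul_mem_mul (by simpa using hσ : π - (σ * (1 : χ.ker)) • π ∈ _) h1
    rwa [← pow_add, show 3 + 2 * (q - 1) = 2 * q + 1 by omega] at h2
  have hfinal := Ideal.mem_of_dvd _ hdvd hprod
  rw [← dvrValuation_algebraMap_le_iff (K := E), map_sub, algebraMap.smul', hy, AlgEquiv.smul_def,
    map_inv₀, hχ, ← hc, show α⁻¹ - (α + c)⁻¹ = c * (α⁻¹ * (α + c)⁻¹) by field_simp; ring,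
    ← hv, map_mul, map_mul, map_inv₀, map_inv₀, hvc, hvα, hvαc, one_mul, ← WithZero.exp_neg,
    ← WithZero.exp_add, WithZero.exp_le_exp] at hfinal
  push_cast at hfinal
  omega

end ArtinSchreier

/-! ### The second ramification group -/

theorem smul_sub_dvd_smul_sub {R S G : Type*} [CommRing R] [CommRing S] [Algebra R S]
    [Group G] [MulSemiringAction G S] [SMulCommClass G R S] {x y : S}
    (hy : y ∈ Algebra.adjoin R {x}) (g : G) : g • x - x ∣ g • y - y := by
  obtain ⟨f, rfl⟩ := Algebra.adjoin_singleton_eq_range_aeval R x ▸ hy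
  have := Polynomial.aeval_algHom_apply (MulSemiringAction.toAlgHom R S g) x f
  simp only [MulSemiringAction.toAlgHom_apply] at this
  simp only [AlgHom.toRingHom_eq_coe, RingHom.coe_coe]
  rw [← this, ← Polynomial.eval_map_algebraMap, ← Polynomial.eval_map_algebraMap]
  exact Polynomial.sub_dvd_eval_sub _ _ _

theorem mem_ramificationGroup_iff {R S K E : Type*} [CommRing R]
    [CommRing S] [IsDomain S] [IsDiscreteValuationRing S] [Algebra R S] [Algebra.IsIntegral R S]
    [Field K] [Algebra R K] [Field E] [Algebra S E] [IsFractionRing S E] [Algebra K E]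
    [Algebra R E] [IsScalarTower R S E] [IsScalarTower R K E]
    [MulSemiringAction Gal(E/K) S] [SMulDistribClass Gal(E/K) S E] {n : ℕ} {σ : Gal(E/K)} :
    σ ∈ ramificationGroup R S K E n ↔
      ∀ s : S, σ • s - s ∈ IsLocalRing.maximalIdeal S ^ (n + 1) := by
  refine forall_congr' fun s => ?_
  rw [← dvrValuation_algebraMap_le_iff (K := E), map_sub (algebraMap S E), algebraMap.smul']
  push_cast
  rfl

theorem mainTheorem3 (p : ℕ) [Fact p.Prime] (k R S K E : Type*)
    [Field k] [CharP k p] [PerfectField k]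
    [CommRing R] [IsDomain R] [IsDiscreteValuationRing R]
    [IsAdicComplete (IsLocalRing.maximalIdeal R) R]
    [Algebra k R] [PerfectField (IsLocalRing.ResidueField R)]
    [CommRing S] [IsDomain S] [IsDiscreteValuationRing S]
    [IsAdicComplete (IsLocalRing.maximalIdeal S) S]
    [Algebra R S] [Module.Finite R S]
    [Field K] [Algebra R K] [IsFractionRing R K]
    [Field E] [Algebra S E] [IsFractionRing S E]
    [Algebra K E] [Algebra R E] [IsScalarTower R S E] [IsScalarTower R K E]
    [IsGalois K E]
    (hG : ramificationGroup R S K E 1 = ⊤) :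
    ramificationGroup R S K E 2 = (conductorOneSubfield R K E p).fixingSubgroup := by
  have hp : p.Prime := Fact.out
  have : CharP R p := charP_of_injective_algebraMap (algebraMap k R).injective p
  have : CharP K p := charP_of_injective_algebraMap (IsFractionRing.injective R K) p
  have : CharP E p := charP_of_injective_algebraMap (algebraMap K E).injective p
  have : FaithfulSMul R S := FaithfulSMul.of_field_isFractionRing R S K E
  have : IsIntegralClosure S R E := IsIntegralClosure.of_isIntegrallyClosed S R E
  have : IsLocalization (Algebra.algebraMapSubmonoid S (nonZeroDivisors R)) E :=
    IsIntegralClosure.isLocalization R K E S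
  have : FiniteDimensional K E := .of_isLocalization R S (nonZeroDivisors R)
  let _ : MulSemiringAction Gal(E/K) S := IsIntegralClosure.MulSemiringAction R K E S
  have : SMulDistribClass Gal(E/K) S E := inferInstance
  have : SMulCommClass Gal(E/K) R S := ⟨fun σ r s => map_smul (galRestrict R K E S σ) r s⟩
  have : Algebra.IsInvariant R S Gal(E/K) := Algebra.isInvariant_of_isGalois R K E S
  have hG1 (σ : Gal(E/K)) (s : S) : σ • s - s ∈ IsLocalRing.maximalIdeal S ^ 2 :=
    mem_ramificationGroup_iff (R := R) (n := 1).mp (by rw [Nat.cast_one, hG]; trivial) s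
  have hres := residueField_algebraMap_surjective (R := R) (S := S) (G := Gal(E/K))
    fun σ s => Ideal.pow_le_self two_ne_zero (hG1 σ s)
  have hvw := dvrValuation_algebraMap_eq_pow (K := K) (E := E) hres
  obtain ⟨π, hπ⟩ := IsDiscreteValuationRing.exists_irreducible S
  have hgen := adjoin_irreducible_eq_top hres hπ
  have hmem (σ : Gal(E/K)) :
      σ ∈ ramificationGroup R S K E 2 ↔ σ • π - π ∈ IsLocalRing.maximalIdeal S ^ 3 :=
    (mem_ramificationGroup_iff (n := 2)).trans ⟨fun h => h π, fun h s =>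
      Ideal.mem_of_dvd _ (smul_sub_dvd_smul_sub (R := R) (hgen ▸ Algebra.mem_top) σ) h⟩
  refine le_antisymm ?_ fun σ hσL => ?_
  · rw [← IntermediateField.le_iff_le, conductorOneSubfield, IntermediateField.adjoin_le_iff]
    rintro α ⟨β, hβ, hwβ⟩
    rw [SetLike.mem_coe, IntermediateField.mem_fixedField_iff]
    intro σ hσ
    refine apply_eq_of_mem_pow_three p hvw hβ hwβ hgen (fun τ => ?_) ?_
    · rw [← neg_sub]
      exact neg_mem (hG1 τ π)
    · rw [← neg_sub]
      exact neg_mem ((hmem σ).mp hσ)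
  · rw [hmem]
    by_contra hσ
    obtain ⟨a, ha⟩ := exists_residue_character hG1 hπ
    have haσ : a σ ≠ 1 := by
      intro h
      obtain ⟨s, hs, has⟩ := ha σ
      rw [has, ofAdd_eq_one, IsLocalRing.residue_eq_zero_iff] at h
      refine hσ (hs ▸ ?_)
      rw [pow_succ]
      refine Ideal.mul_mem_mul (Ideal.pow_mem_pow ?_ 2) h
      rw [hπ.maximalIdeal_eq]
      exact Ideal.mem_span_singleton_self π
    have : CharP (IsLocalRing.ResidueField S) p := by
      refine (CharP.charP_iff_prime_eq_zero hp).mpr ?_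
      have : (p : S) = 0 := by
        rw [← map_natCast (algebraMap R S), CharP.cast_eq_zero, map_zero]
      rw [← map_natCast (IsLocalRing.residue S), this, map_zero]
    obtain ⟨χ, hχσ, hχa⟩ := exists_character_ne_one p a haσ
    have hjump (τ : Gal(E/K)) (hτ : χ τ ≠ 1) :
        dvrValuation S E (algebraMap S E (π - τ • π)) = WithZero.exp (-2) := by
      obtain ⟨s, hs, has⟩ := ha τ
      have hs1 : dvrValuation S E (algebraMap S E s) = 1 := by
        refine IsDedekindDomain.HeightOneSpectrum.valuation_eq_one_iff_notMem _ |>.mpr fun h => ?_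
        refine hχa τ hτ (has ▸ ?_)
        rw [ofAdd_eq_one, IsLocalRing.residue_eq_zero_iff]
        exact h
      rw [← neg_sub, hs, map_neg, Valuation.map_neg, map_mul, map_pow, map_mul, map_pow, hs1,
        dvrValuation_irreducible hπ, mul_one, ← WithZero.exp_nsmul]
      rfl
    obtain ⟨α₀, β₀, hβ₀, hχ₀⟩ := exists_artinSchreier_generator p χ
    obtain ⟨c, hc⟩ := exists_sub_artinSchreier_reduced (R := R) p β₀
    set β := β₀ - (c ^ p - c) with hβdef
    set α := α₀ - algebraMap K E c with hαdef
    have hβ : algebraMap K E β = α ^ p - α := by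
      rw [hβdef, hαdef, map_sub, hβ₀, sub_pow_char, map_sub, map_pow]
      ring
    have hχ (τ : Gal(E/K)) : τ α = α + ZMod.castHom dvd_rfl E (χ τ).toAdd := by
      rw [hαdef, map_sub, hχ₀, AlgEquiv.commutes]
      ring
    have hc0 : ZMod.castHom (dvd_refl p) E (χ σ).toAdd ≠ 0 := by
      rw [Ne, map_eq_zero, toAdd_eq_zero]
      exact hχσ
    rcases hc with hc | ⟨m, hm, hwβ⟩
    -- Here `α` is integral and `σ α - α` is a unit, which is impossible as `σ ∈ G₁`.
    · have hα1 : dvrValuation S E α ≤ 1 := by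
        have h1 : dvrValuation S E (α ^ p - α) ≤ 1 := by
          rw [← hβ, hvw]
          exact pow_le_one' hc _
        by_contra! hlt
        rw [Valuation.map_sub_eq_of_lt_left, map_pow] at h1
        · exact (one_lt_pow' hlt hp.ne_zero).not_ge h1
        · rw [map_pow]
          exact lt_self_pow₀ hlt hp.one_lt
      obtain ⟨y, hy⟩ := (dvrValuation_le_one_iff α).mp hα1
      have h2 := (dvrValuation_algebraMap_le_iff (K := E) _ _).mpr (hG1 σ y)
      rw [map_sub, algebraMap.smul', hy, AlgEquiv.smul_def, hχ, add_sub_cancel_left,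
        Valuation.map_eq_one_of_pow_eq _ hp.one_lt hc0 (castHom_pow_eq p _), ← WithZero.exp_zero,
        WithZero.exp_le_exp] at h2
      omega
    · have hm1 := le_one_of_artinSchreier p hvw hβ hχ hχσ hm hwβ hjump
      obtain rfl : m = 1 := le_antisymm hm1 (Nat.pos_of_ne_zero (by
        rintro rfl
        exact hm (dvd_zero p)))
      have hαL : α ∈ conductorOneSubfield R K E p :=
        IntermediateField.subset_adjoin _ _ ⟨β, hβ, hwβ⟩
      have := (IntermediateField.mem_fixingSubgroup_iff _ _).mp hσL α hαL
      rw [hχ, add_eq_left] at this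
      exact hc0 this
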